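/- All groups are finite. Let $t$ be a natural number ($t=0$ is allowed). A subgroup $H$ of a group $G$ is called $\mathrm{K}$-$\mathbb{P}_t$-subnormal in $G$ if there is a chain of subgroups $H=H_0\le H_1\le\dots\le H_n=G$ such that for every $i=1,\dots,n$ either $H_{i-1}$ is normal in $H_i$, or $|H_i:H_{i-1}|$ is a prime $p$ such that $p-1$ is not divisible by $q^{t+1}$ for any prime $q$. Let $\mathfrak{H}$ be the class of all groups in which every Sylow subgroup is $\mathrm{K}$-$\mathbb{P}_t$-subnormal. A group $G$ of order $p_1^{\alpha_1}\cdots p_n^{\alpha_n}$, with primes $p_1>\dots>p_n$ and $\alpha_i\ge 1$, is called Ore dispersive (a Sylow tower group) if for every $i=1,\dots,n$ it has a normal subgroup of order $p_1^{\alpha_1}\cdots p_i^{\alpha_i}$. $\Phi(G)$ denotes the Frattini subgroup of $G$. **Theorem 3.1.** The following assertions hold. 1. Every nilpotent group belongs to $\mathfrak{H}$, and every group in $\mathfrak{H}$ is Ore dispersive. 2. If $G\in\mathfrak{H}$ and $N\trianglelefteq G$, then $G/N\in\mathfrak{H}$. 3. If $G$ is a group, $N_1,N_2\trianglelefteq G$,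 $G/N_1\in\mathfrak{H}$ and $G/N_2\in\mathfrak{H}$, then $G/(N_1\cap N_2)\in\mathfrak{H}$. 4. A direct product of (finitely many) groups from $\mathfrak{H}$ belongs to $\mathfrak{H}$. 5. If $G\in\mathfrak{H}$ and $U$ is a subgroup of $G$, then $U\in\mathfrak{H}$. 6. If $G$ is a group with $G/\Phi(G)\in\mathfrak{H}$, then $G\in\mathfrak{H}$. 7. $\mathfrak{H}$ is a hereditary saturated formation; that is, it is an isomorphism-closed class of groups that is closed under quotients (as in 2), closed under subdirect products in the sense of 3 (a formation), closed under subgroups (hereditary), and contains every group $G$ with $G/\Phi(G)\in\mathfrak{H}$ (saturated). -/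

import Mathlib

universe u v w

/-- The step condition of a `K`-`ℙ_t`-subnormal chain: `A ≤ B`, and either `A` is normal in `B` or
`|B : A|` is a prime `p` such that `p - 1` is not divisible by the `(t+1)`-th power of any prime. -/
def IsKPtStep (t : ℕ) {G : Type u} [Group G] (A B : Subgroup G) : Prop :=
  A ≤ B ∧ ((A.subgroupOf B).Normal ∨
    ∃ p : ℕ, p.Prime ∧ A.relIndex B = p ∧ ∀ q : ℕ, q.Prime → ¬ q ^ (t + 1) ∣ p - 1)

/-- `H` is `K`-`ℙ_t`-subnormal in `G`: there is a chain `H = c 0 ≤ c 1 ≤ ⋯ ≤ c n = G` each step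
of which satisfies `IsKPtStep t` (the values of `c` beyond `n` are irrelevant). -/
def IsKPtSubnormal (t : ℕ) {G : Type u} [Group G] (H : Subgroup G) : Prop :=
  ∃ (n : ℕ) (c : ℕ → Subgroup G), c 0 = H ∧ c n = ⊤ ∧ ∀ i < n, IsKPtStep t (c i) (c (i + 1))

/-- The class of all finite groups in which every Sylow subgroup (for every prime) is
`K`-`ℙ_t`-subnormal. -/
def SylowKPtClass (t : ℕ) (G : Type u) [Group G] : Prop :=
  Finite G ∧ ∀ p : ℕ, p.Prime → ∀ P : Sylow p G, IsKPtSubnormal t (P : Subgroup G)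

/-- A finite group `G` of order `p₁ ^ α₁ * ⋯ * pₙ ^ αₙ`, `p₁ > ⋯ > pₙ`, is Ore dispersive (a Sylow
tower group) if for every `i` it has a normal subgroup of order `p₁ ^ α₁ * ⋯ * pᵢ ^ αᵢ`. Here
`p` plays the role of `pᵢ`, and the product runs over the prime divisors `q ≥ p` of `|G|`. -/
def IsOreDispersive (G : Type u) [Group G] : Prop :=
  Finite G ∧ ∀ p ∈ (Nat.card G).primeFactors, ∃ N : Subgroup G, N.Normal ∧
    Nat.card N =
      ∏ q ∈ (Nat.card G).primeFactors with p ≤ q, q ^ (Nat.card G).factorization q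

/-- A property of groups (in a fixed universe). -/
abbrev GroupProperty : Type (u + 1) := ∀ (G : Type u) [Group G], Prop

/-- A class of finite groups: it consists of finite groups and is closed under isomorphism. -/
structure IsFiniteGroupClass (F : GroupProperty.{u}) : Prop where
  finite : ∀ (G : Type u) [Group G], F G → Finite G
  iso : ∀ (G K : Type u) [Group G] [Group K], Nonempty (G ≃* K) → F G → F K

/-- A formation of finite groups: closed under quotients and, for normal subgroups `N₁`, `N₂` of
a finite group `G`, `G/N₁, G/N₂ ∈ F` implies `G/(N₁ ∩ N₂) ∈ F`. -/
structure IsFormation (F : GroupProperty.{u}) : Prop extends IsFiniteGroupClass F where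
  quotient : ∀ (G : Type u) [Group G] (N : Subgroup G) [N.Normal], F G → F (G ⧸ N)
  subdirect : ∀ (G : Type u) [Group G] [Finite G] (N₁ N₂ : Subgroup G) [N₁.Normal] [N₂.Normal],
    F (G ⧸ N₁) → F (G ⧸ N₂) → F (G ⧸ (N₁ ⊓ N₂))

/-- A class of groups is hereditary if it is closed under subgroups. -/
def IsHereditary (F : GroupProperty.{u}) : Prop :=
  ∀ (G : Type u) [Group G] (U : Subgroup G), F G → F U

/-- A class of finite groups is saturated if `G/Φ(G) ∈ F` implies `G ∈ F` for finite `G`. -/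
def IsSaturated (F : GroupProperty.{u}) : Prop :=
  ∀ (G : Type u) [Group G] [Finite G], F (G ⧸ frattini G) → F G

open Subgroup Relation
open scoped commutatorElement

/-! Call a prime `r` admissible if no `s ^ (t + 1)` with `s` prime divides `r - 1`.

Let `p` be the largest prime divisor of the order. In a chain from a Sylow `p`-subgroup to the whole
group every non-normal step has prime index below `p`, so `p`-elements of the lower term lie in its
core in the upper one. Hence the Sylow `p`-subgroup is normal, and induction on quotients gives the
Sylow tower and solvability.

The obstacle to heredity is that a step of prime index `p` may meet a subgroup in an index other
than `p`. In a solvable group this is harmless: modulo its core, a subgroup of index `p` is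
complemented by a normal subgroup of order `p` containing the derived subgroup, so the intersection
is normal or has index exactly `p` (`conj_mem_or_relIndex_eq_of_index_prime`). Chains can therefore
be pulled back along homomorphisms and intersected. For jointly injective maps to members, a Sylow
subgroup is an intersection of preimages of Sylow subgroups; this yields subgroups, subdirect
products and direct products together.

For saturation, let `R` be the normal Sylow subgroup for the largest prime `r`. If a nontrivial
normal subgroup meets `R` trivially, the group is a subdirect product of smaller members. Otherwise
take a Sylow `q`-subgroup `Q`, `q ≠ r`. A chain from `Q` to `QR` forces commutators and `(r - 1)`-th
powers in `Q`, and all of `Q` if `r` is not admissible, to centralize `R`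
(`commute_of_reflTransGen_isKPtStep`). Applied modulo the Frattini subgroup, this makes such
elements trivial in the group itself (`eq_one_of_commute_quotient_frattini`). So `Q` is trivial, or
`r` is admissible and `Q` is abelian of exponent dividing `r - 1`; in the latter case its action is
diagonalizable over the field of `r` elements, and `QR` is reached by steps of index `r`. The rest
of the chain comes from the quotient by `R`. -/

/-! ### Chains and their images -/

theorem isKPtSubnormal_iff_reflTransGen {t : ℕ} {G : Type u} [Group G] {H : Subgroup G} :
    IsKPtSubnormal t H ↔ ReflTransGen (IsKPtStep t) H ⊤ := by
  constructor
  · rintro ⟨n, c, rfl, hn, hc⟩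
    have key : ∀ i ≤ n, ReflTransGen (IsKPtStep t) (c 0) (c i) := by
      intro i
      induction i with
      | zero => exact fun _ => .refl
      | succ i ih => exact fun hi => (ih (by omega)).tail (hc i (by omega))
    exact hn ▸ key n le_rfl
  · intro h
    induction h using ReflTransGen.head_induction_on with
    | refl => exact ⟨0, fun _ => ⊤, rfl, rfl, fun i hi => by omega⟩
    | head hAB _ ih =>
      rename_i A B _
      obtain ⟨n, c, h0, hn, hc⟩ := ih
      refine ⟨n + 1, fun i => Nat.casesOn i A c, rfl, hn, fun i hi => ?_⟩
      cases i with
      | zero => simpa [h0] using hAB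
      | succ i => exact hc i (by omega)

theorem isKPtStep_of_conj_mem {t : ℕ} {G : Type u} [Group G] {A B : Subgroup G} (hAB : A ≤ B)
    (h : ∀ a ∈ A, ∀ b ∈ B, b * a * b⁻¹ ∈ A) : IsKPtStep t A B :=
  ⟨hAB, .inl ((normal_subgroupOf_iff hAB).2 fun a b ha hb => h a ha b hb)⟩

theorem isKPtStep_of_normal {t : ℕ} {G : Type u} [Group G] {A B : Subgroup G} (hAB : A ≤ B)
    (h : A.Normal) : IsKPtStep t A B :=
  isKPtStep_of_conj_mem hAB fun a ha b _ => h.conj_mem a ha b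

/-- The index of the images divides the original one, so a step of prime index keeps its prime or
collapses to an equality. -/
theorem IsKPtStep.map {t : ℕ} {G : Type u} {K : Type v} [Group G] [Group K] (f : G →* K)
    {A B : Subgroup G} (h : IsKPtStep t A B) : IsKPtStep t (A.map f) (B.map f) := by
  obtain ⟨hAB, h | ⟨p, hp, hi, hq⟩⟩ := h
  · rw [normal_subgroupOf_iff hAB] at h
    refine isKPtStep_of_conj_mem (map_mono hAB) ?_
    rintro _ ⟨a, ha, rfl⟩ _ ⟨b, hb, rfl⟩
    exact ⟨b * a * b⁻¹, h a b ha hb, by simp⟩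
  · have hd : (A.map f).relIndex (B.map f) ∣ p := by
      rw [← relIndex_comap, ← hi]
      exact relIndex_dvd_of_le_left _ (le_comap_map f A)
    rcases (Nat.dvd_prime hp).1 hd with h1 | h1
    · rw [relIndex_eq_one] at h1
      rw [le_antisymm h1 (map_mono hAB)]
      exact isKPtStep_of_conj_mem le_rfl
        fun a ha b hb => mul_mem (mul_mem hb ha) (inv_mem hb)
    · exact ⟨map_mono hAB, .inr ⟨p, hp, h1, hq⟩⟩

theorem reflTransGen_isKPtStep_map {t : ℕ} {G : Type u} {K : Type v} [Group G] [Group K]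
    (f : G →* K) {A B : Subgroup G} (h : ReflTransGen (IsKPtStep t) A B) :
    ReflTransGen (IsKPtStep t) (A.map f) (B.map f) :=
  h.lift (fun A => A.map f) fun _ _ h => h.map f

theorem SylowKPtClass.of_surjective {t : ℕ} {G : Type u} {K : Type v} [Group G] [Group K]
    (hG : SylowKPtClass t G) (f : G →* K) (hf : Function.Surjective f) : SylowKPtClass t K := by
  have := hG.1
  refine ⟨Finite.of_surjective f hf, fun p hp P => ?_⟩
  have : Fact p.Prime := ⟨hp⟩
  obtain ⟨Q, rfl⟩ := Sylow.mapSurjective_surjective hf p P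
  have h := isKPtSubnormal_iff_reflTransGen.1 (hG.2 p hp Q)
  have h2 := reflTransGen_isKPtStep_map f h
  rw [map_top_of_surjective f hf] at h2
  exact isKPtSubnormal_iff_reflTransGen.2 h2

theorem SylowKPtClass.quotient {t : ℕ} {G : Type u} [Group G] (hG : SylowKPtClass t G)
    (N : Subgroup G) [N.Normal] : SylowKPtClass t (G ⧸ N) :=
  hG.of_surjective (QuotientGroup.mk' N) (QuotientGroup.mk'_surjective N)

theorem reflTransGen_isKPtStep_le {t : ℕ} {G : Type u} [Group G] {A B : Subgroup G}
    (h : ReflTransGen (IsKPtStep t) A B) : A ≤ B := by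
  induction h with
  | refl => exact le_rfl
  | tail _ h ih => exact ih.trans h.1

/-! ### The Sylow tower of a member -/

/-- An element of `p`-power order lies in every conjugate of a subgroup of index less than `p`
that contains it. -/
theorem conj_mem_of_index_lt {G : Type u} [Group G] {p : ℕ} (hp : p.Prime)
    {B : Subgroup G} (hB : B.index ≠ 0) (hlt : B.index < p) {x : G} {k : ℕ}
    (hx : x ^ p ^ k = 1) (c : G) : c * x * c⁻¹ ∈ B := by
  have : B.FiniteIndex := ⟨hB⟩
  have : Finite (G ⧸ B) := inferInstance
  classical
  have := Fintype.ofFinite (G ⧸ B)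
  have hcard : Fintype.card (G ⧸ B) = B.index := by
    rw [← Nat.card_eq_fintype_card]; rfl
  have h1 : orderOf (MulAction.toPermHom G (G ⧸ B) x) ∣ p ^ k := by
    rw [orderOf_dvd_iff_pow_eq_one, ← map_pow, hx, map_one]
  have h2 : orderOf (MulAction.toPermHom G (G ⧸ B) x) ∣ B.index.factorial := by
    rw [← hcard, ← Fintype.card_perm]
    exact orderOf_dvd_card
  -- As `B.index < p`, the symmetric group on the cosets has order prime to `p`, so `x` acts
  -- trivially and lies in the core.
  have h3 : (p ^ k).Coprime B.index.factorial := by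
    apply Nat.Coprime.pow_left
    rw [hp.coprime_iff_not_dvd, hp.dvd_factorial]
    omega
  have h4 : MulAction.toPermHom G (G ⧸ B) x = 1 :=
    orderOf_eq_one_iff.1 (Nat.eq_one_of_dvd_coprimes h3 h1 h2)
  have h5 : x ∈ B.normalCore := by
    rw [normalCore_eq_ker]; exact h4
  exact h5 c

theorem Sylow.mem_of_conj_mem {G : Type u} [Group G] {p : ℕ} (P : Sylow p G) {x : G}
    {k : ℕ} (hx : x ^ p ^ k = 1) (hn : ∀ g, g ∈ P ↔ x * g * x⁻¹ ∈ P) : x ∈ P := by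
  have hz : IsPGroup p (zpowers x) := by
    rintro ⟨y, m, rfl⟩
    refine ⟨k, Subtype.ext ?_⟩
    change (x ^ m) ^ p ^ k = 1
    rw [← zpow_natCast, ← zpow_mul, mul_comm, zpow_mul, zpow_natCast, hx, one_zpow]
  have h := hz.inf_normalizer_sylow P
  have hm : x ∈ zpowers x ⊓ normalizer (P : Set G) :=
    ⟨mem_zpowers x, mem_normalizer_iff.2 hn⟩
  rw [h] at hm
  exact hm.2

theorem Sylow.normal_of_isKPtSubnormal {t : ℕ} {G : Type u} [Group G] [Finite G] {p : ℕ}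
    (hp : p.Prime) (hmax : ∀ r, r.Prime → r ∣ Nat.card G → r ≤ p) (P : Sylow p G)
    (hP : IsKPtSubnormal t (P : Subgroup G)) : (P : Subgroup G).Normal := by
  have : Fact p.Prime := ⟨hp⟩
  rw [isKPtSubnormal_iff_reflTransGen] at hP
  suffices h : ∀ C : Subgroup G, ReflTransGen (IsKPtStep t) P C →
      ∀ c ∈ C, ∀ x ∈ P, c * x * c⁻¹ ∈ P from ⟨fun x hx c => h ⊤ hP c trivial x hx⟩
  intro C hC
  induction hC with
  | refl => exact fun c hc x hx => mul_mem (mul_mem hc hx) (inv_mem hc)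
  | tail hPB hBC ih =>
    rename_i B C
    intro c hc x hx
    obtain ⟨k, hk⟩ := P.isPGroup' ⟨x, hx⟩
    have hk : x ^ p ^ k = 1 := congrArg Subtype.val hk
    have hPleB := reflTransGen_isKPtStep_le hPB
    have hxB : c * x * c⁻¹ ∈ B := by
      obtain ⟨hle, h | ⟨r, hr, hi, -⟩⟩ := hBC
      · exact (normal_subgroupOf_iff hle).1 h x c (hPleB hx) hc
      · have hrp : r < p := by
          refine lt_of_le_of_ne (hmax r hr ?_) ?_
          · rw [← hi]
            exact (relIndex_dvd_card B C).trans (card_subgroup_dvd_card C)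
          -- Since `P ≤ B`, an index `p` of `B` in `C` would make `p` divide the index of `P`.
          · rintro rfl
            apply P.not_dvd_index
            rw [← relIndex_mul_index hPleB, ← relIndex_mul_index hle, hi]
            exact dvd_mul_of_dvd_right (dvd_mul_right _ _) _
        have := conj_mem_of_index_lt hp (B := B.subgroupOf C) (x := ⟨x, hle (hPleB hx)⟩) (k := k)
          (by change B.relIndex C ≠ 0; rw [hi]; exact hr.ne_zero)
          (by change B.relIndex C < p; rwa [hi]) (Subtype.ext hk) ⟨c, hc⟩
        simpa [mem_subgroupOf] using this
    -- By `ih` the `p`-element `c * x * c⁻¹` of `B` normalizes `P`, hence lies in it.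
    refine P.mem_of_conj_mem (k := k) (by rw [conj_pow, hk]; group) fun g => ⟨ih _ hxB g, fun hg => ?_⟩
    have := ih _ (inv_mem hxB) _ hg
    convert this using 1
    group

theorem SylowKPtClass.exists_normal_sylow {t : ℕ} {G : Type u} [Group G]
    (hG : SylowKPtClass t G) (h1 : Nat.card G ≠ 1) :
    ∃ r, r.Prime ∧ r ∣ Nat.card G ∧ (∀ q, q.Prime → q ∣ Nat.card G → q ≤ r) ∧
      ∀ P : Sylow r G, (P : Subgroup G).Normal := by
  have := hG.1
  have hne : (Nat.card G).primeFactors.Nonempty :=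
    Nat.nonempty_primeFactors.2 (by have := Nat.card_pos (α := G); omega)
  have hr := Finset.max'_mem _ hne
  have hmax : ∀ q, q.Prime → q ∣ Nat.card G → q ≤ (Nat.card G).primeFactors.max' hne :=
    fun q hq hd => Finset.le_max' _ _ (Nat.mem_primeFactors.2 ⟨hq, hd, Nat.card_pos.ne'⟩)
  rw [Nat.mem_primeFactors] at hr
  exact ⟨_, hr.1, hr.2.1, hmax, fun P => P.normal_of_isKPtSubnormal hr.1 hmax (hG.2 _ hr.1 P)⟩

theorem Sylow.card_quotient_lt {G : Type u} [Group G] [Finite G] {r : ℕ}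
    (hr : r.Prime) (hd : r ∣ Nat.card G) (P : Sylow r G) :
    Nat.card (G ⧸ (P : Subgroup G)) < Nat.card G := by
  have : Fact r.Prime := ⟨hr⟩
  have h1 := card_eq_card_quotient_mul_card_subgroup (P : Subgroup G)
  have h2 : 1 < Nat.card P := by
    have := P.dvd_card_of_dvd_card hd
    exact lt_of_lt_of_le hr.one_lt (Nat.le_of_dvd Nat.card_pos this)
  have h3 : 0 < Nat.card (G ⧸ (P : Subgroup G)) := Nat.card_pos
  nlinarith

theorem SylowKPtClass.isSolvable {t : ℕ} {G : Type u} [Group G] (hG : SylowKPtClass t G) :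
    Group.IsSolvable G := by
  induction hn : Nat.card G using Nat.strong_induction_on generalizing G with
  | _ n ih =>
  subst hn
  have := hG.1
  by_cases h1 : Nat.card G = 1
  · have := (Nat.card_eq_one_iff_unique.1 h1).1
    infer_instance
  · obtain ⟨r, hr, hd, -, hP⟩ := hG.exists_normal_sylow h1
    have : Fact r.Prime := ⟨hr⟩
    obtain ⟨P⟩ := (inferInstance : Nonempty (Sylow r G))
    have := hP P
    have := ih _ (P.card_quotient_lt hr hd) (hG.quotient (P : Subgroup G)) rfl
    have := P.isPGroup'.isNilpotent
    exact Group.isSolvable_of_ker_le_range (P : Subgroup G).subtype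
      (QuotientGroup.mk' (P : Subgroup G)) (by simp)

theorem Subgroup.card_comap_mk' {G : Type u} [Group G] [Finite G] (N : Subgroup G) [N.Normal]
    (M : Subgroup (G ⧸ N)) :
    Nat.card (M.comap (QuotientGroup.mk' N)) = Nat.card M * Nat.card N := by
  have h1 := index_comap_of_surjective M (QuotientGroup.mk'_surjective N)
  have h2 := (M.comap (QuotientGroup.mk' N)).card_mul_index
  have h3 := M.card_mul_index
  have h4 := card_eq_card_quotient_mul_card_subgroup N
  have h5 : M.index ≠ 0 := index_ne_zero_of_finite
  rw [h1, h4, ← h3] at h2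
  exact mul_right_cancel₀ h5 (h2.trans (by ring))

theorem SylowKPtClass.isOreDispersive {t : ℕ} {G : Type u} [Group G] (hG : SylowKPtClass t G) :
    IsOreDispersive G := by
  induction hn : Nat.card G using Nat.strong_induction_on generalizing G with
  | _ n ih =>
  subst hn
  have := hG.1
  refine ⟨hG.1, fun p hp => ?_⟩
  have hp' := Nat.mem_primeFactors.1 hp
  have h1 : Nat.card G ≠ 1 := fun h => hp'.1.one_lt.ne' (Nat.dvd_one.1 (h ▸ hp'.2.1))
  obtain ⟨r, hr, hd, hmax, hP⟩ := hG.exists_normal_sylow h1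
  have : Fact r.Prime := ⟨hr⟩
  obtain ⟨P⟩ := (inferInstance : Nonempty (Sylow r G))
  have hPn := hP P
  have hcard := card_eq_card_quotient_mul_card_subgroup (P : Subgroup G)
  have hPc := P.card_eq_multiplicity
  rcases (hmax p hp'.1 hp'.2.1).eq_or_lt with rfl | hpr
  · refine ⟨P, hPn, ?_⟩
    have : (Nat.card G).primeFactors.filter (p ≤ ·) = {p} := by
      ext q
      simp only [Finset.mem_filter, Finset.mem_singleton]
      constructor
      · rintro ⟨hq, hpq⟩
        have hq := Nat.mem_primeFactors.1 hq
        exact le_antisymm (hmax q hq.1 hq.2.1) hpq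
      · rintro rfl
        exact ⟨hp, le_rfl⟩
    rw [this, Finset.prod_singleton, hPc]
  · set m := Nat.card (G ⧸ (P : Subgroup G)) with hm
    have hrm : ¬ r ∣ m := P.not_dvd_index
    have hm0 : m ≠ 0 := Nat.card_pos.ne'
    have hP0 : Nat.card P ≠ 0 := Nat.card_pos.ne'
    have hv : (Nat.card G).factorization r ≠ 0 :=
      (hr.factorization_pos_of_dvd Nat.card_pos.ne' hd).ne'
    have hpf : (Nat.card G).primeFactors = insert r m.primeFactors := by
      rw [hcard, Nat.primeFactors_mul hm0 hP0, hPc, Nat.primeFactors_prime_pow hv hr,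
        Finset.union_comm, Finset.insert_eq]
    have hpm : p ∈ m.primeFactors := by
      rw [hpf, Finset.mem_insert] at hp
      exact hp.resolve_left hpr.ne
    obtain ⟨N, hN, hNc⟩ := (ih m (P.card_quotient_lt hr hd) (hG.quotient (P : Subgroup G)) rfl).2 p hpm
    refine ⟨N.comap (QuotientGroup.mk' (P : Subgroup G)), inferInstance, ?_⟩
    have hrn : r ∉ m.primeFactors := fun h => hrm (Nat.mem_primeFactors.1 h).2.1
    rw [card_comap_mk', hNc, hpf, Finset.filter_insert, if_pos hpr.le, Finset.prod_insert
      (fun h => hrn (Finset.mem_filter.1 h).1), hPc, mul_comm]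
    congr 1
    refine Finset.prod_congr rfl fun q hq => ?_
    have hqr : q ≠ r := fun h => hrn (h ▸ (Finset.mem_filter.1 hq).1)
    rw [hcard, Nat.factorization_mul hm0 hP0, hPc, hr.factorization_pow, Finsupp.add_apply,
      Finsupp.single_eq_of_ne hqr, add_zero]

/-! ### Subgroups of prime index in solvable groups -/

/-- The action by conjugation on a normal subgroup of prime order is commutative of exponent
dividing `p - 1`. -/
theorem commute_of_card_normal_eq_prime {G : Type u} [Group G] {p : ℕ} (hp : p.Prime)
    (V : Subgroup G) [V.Normal] (hV : Nat.card V = p) :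
    (∀ y z : G, ∀ v ∈ V, Commute ⁅y, z⁆ v) ∧ ∀ y : G, ∀ v ∈ V, Commute (y ^ (p - 1)) v := by
  have : Fact p.Prime := ⟨hp⟩
  have : IsCyclic V := isCyclic_of_prime_card hV
  have e := IsCyclic.mulAutMulEquiv V
  rw [hV] at e
  have key : ∀ x : G, MulAut.conjNormal (H := V) x = 1 → ∀ v ∈ V, Commute x v := by
    intro x hx v hv
    have := congrArg (fun f : MulAut V => (f ⟨v, hv⟩ : G)) hx
    simp only [MulAut.conjNormal_apply, MulAut.one_apply] at this
    exact mul_inv_eq_iff_eq_mul.1 this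
  refine ⟨fun y z => key _ ?_, fun y => key _ ?_⟩
  · apply e.injective
    simp [map_commutatorElement, commutatorElement_eq_one_iff_mul_comm, mul_comm]
  · apply e.injective
    rw [map_pow, map_pow, ZMod.units_pow_card_sub_one_eq_one, map_one]

/-- In a finite solvable group with a core-free subgroup of prime index `p`, there is a normal
subgroup of order `p` that contains the derived subgroup. -/
theorem exists_normal_of_normalCore_eq_bot {G : Type u} [Group G] [Finite G] [Group.IsSolvable G]
    {p : ℕ} (hp : p.Prime) (A : Subgroup G) (hA : A.index = p) (hc : A.normalCore = ⊥) :
    ∃ L : Subgroup G, L.Normal ∧ Nat.card L = p ∧ commutator G ≤ L := by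
  classical
  have hex := (Group.isSolvable_def (G := G)).1 inferInstance
  have hn := Nat.find_spec hex
  have hmin := fun k => Nat.find_min hex (m := k)
  set n := Nat.find hex
  have hcore : ∀ N : Subgroup G, N.Normal → N ≤ A → N = ⊥ := fun N _ hN => by
    rw [eq_bot_iff, ← hc]; exact normal_le_normalCore.2 hN
  have hmax : ∀ B : Subgroup G, A ≤ B → B = A ∨ B = ⊤ := by
    intro B hAB
    have h := relIndex_mul_index hAB
    rw [hA] at h
    rcases (Nat.dvd_prime hp).1 (Dvd.intro _ h) with h1 | h1
    · exact .inl (le_antisymm (relIndex_eq_one.1 h1) hAB)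
    · rw [h1] at h
      exact .inr (index_eq_one.1 (Nat.eq_of_mul_eq_mul_left hp.pos (by simpa using h)))
  cases hn0 : n with
  | zero =>
    rw [hn0, derivedSeries_zero] at hn
    have : A = ⊤ := eq_top_iff.2 (hn ▸ bot_le)
    rw [this, index_top] at hA
    exact absurd hA.symm hp.ne_one
  | succ k =>
    -- `L` is the last nontrivial term of the derived series, hence abelian.
    have hL0 : derivedSeries G k ≠ ⊥ := hmin k (by omega)
    rw [hn0, derivedSeries_succ, commutator_eq_bot_iff_le_centralizer] at hn
    set L := derivedSeries G k
    have hLA : ¬ L ≤ A := fun h => hL0 (hcore L inferInstance h)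
    have hsup : A ⊔ L = ⊤ := by
      rcases hmax (A ⊔ L) le_sup_left with h | h
      · exact absurd (h ▸ le_sup_right) hLA
      · exact h
    have hnorm : ∀ N : Subgroup G, N ≤ A → (∀ a ∈ A, ∀ x ∈ N, a * x * a⁻¹ ∈ N) →
        (∀ l ∈ L, ∀ x ∈ N, Commute l x) → N = ⊥ := by
      intro N hNA h1 h2
      refine hcore N ⟨fun x hx g => ?_⟩ hNA
      have hg : g ∈ A ⊔ L := hsup ▸ mem_top g
      obtain ⟨a, ha, l, hl, rfl⟩ := mem_sup_of_normal_right.1 hg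
      have : a * l * x * (a * l)⁻¹ = a * (l * x * l⁻¹) * a⁻¹ := by group
      rw [this, (h2 l hl x hx).eq, mul_inv_cancel_right]
      exact h1 a ha x hx
    have hinf : A ⊓ L = ⊥ := by
      refine hnorm _ inf_le_left (fun a ha x hx => ⟨?_, ?_⟩) fun l hl x hx => ?_
      · exact A.mul_mem (A.mul_mem ha hx.1) (A.inv_mem ha)
      · exact (inferInstance : L.Normal).conj_mem x hx.2 a
      · exact (mem_centralizer_iff.1 (hn hl) x hx.2).symm
    have hLc : Nat.card L = p := by
      have h1 := relIndex_sup_right A L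
      rw [hsup, relIndex_top_right, ← inf_relIndex_right, inf_comm, hinf, relIndex_bot_left] at h1
      have h2 := L.card_mul_index
      rw [h1, ← A.card_mul_index, hA, mul_comm] at h2
      exact Nat.eq_of_mul_eq_mul_left Nat.card_pos h2
    refine ⟨L, inferInstance, hLc, ?_⟩
    have hcomm := (commute_of_card_normal_eq_prime hp L hLc).1
    -- `A` acts faithfully on `L`, which has prime order, so `A` is abelian and the derived subgroup
    -- dies modulo `L`.
    have hAc : ∀ a ∈ A, (∀ l ∈ L, Commute a l) → a = 1 := by
      intro a ha hal
      have : A ⊓ centralizer (L : Set G) = ⊥ := by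
        refine hnorm _ inf_le_left (fun a ha x hx => ⟨?_, ?_⟩) fun l hl x hx => ?_
        · exact A.mul_mem (A.mul_mem ha hx.1) (A.inv_mem ha)
        · exact (inferInstance : (centralizer (L : Set G)).Normal).conj_mem x hx.2 a
        · exact mem_centralizer_iff.1 hx.2 l hl
      rw [← mem_bot, ← this]
      exact ⟨ha, mem_centralizer_iff.2 fun l hl => (hal l hl).symm.eq⟩
    rw [_root_.commutator_def, commutator_le]
    intro y _ z _
    have hy : y ∈ A ⊔ L := hsup ▸ mem_top y
    have hz : z ∈ A ⊔ L := hsup ▸ mem_top z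
    obtain ⟨a, ha, l, hl, rfl⟩ := mem_sup_of_normal_right.1 hy
    obtain ⟨b, hb, m, hm, rfl⟩ := mem_sup_of_normal_right.1 hz
    have hab : ⁅a, b⁆ = 1 := by
      refine hAc _ ?_ (hcomm a b)
      rw [commutatorElement_def]
      exact mul_mem (mul_mem (mul_mem ha hb) (inv_mem ha)) (inv_mem hb)
    rw [← QuotientGroup.eq_one_iff]
    have e1 : ((a * l : G) : G ⧸ L) = a := by simp [(QuotientGroup.eq_one_iff l).2 hl]
    have e2 : ((b * m : G) : G ⧸ L) = b := by simp [(QuotientGroup.eq_one_iff m).2 hm]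
    have := congrArg (QuotientGroup.mk' L) hab
    rw [map_commutatorElement, map_one] at this
    change QuotientGroup.mk' L _ = 1
    rw [map_commutatorElement]
    change ⁅((a * l : G) : G ⧸ L), ((b * m : G) : G ⧸ L)⁆ = 1
    rw [e1, e2]
    exact this

/-- A subgroup of prime index in a finite solvable group meets every subgroup in a subgroup
that is normal or has the same index. -/
theorem conj_mem_or_relIndex_eq_of_index_prime {G : Type u} [Group G] [Finite G]
    [Group.IsSolvable G] {p : ℕ} (hp : p.Prime) (A : Subgroup G) (hA : A.index = p)
    (U : Subgroup G) :
    (∀ a ∈ A ⊓ U, ∀ b ∈ U, b * a * b⁻¹ ∈ A) ∨ A.relIndex U = p := by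
  set f := QuotientGroup.mk' A.normalCore with hf
  have hfs : Function.Surjective f := QuotientGroup.mk'_surjective _
  have hAA : (A.map f).comap f = A := by
    rw [comap_map_eq, hf, QuotientGroup.ker_mk', sup_eq_left]
    exact normalCore_le A
  have hi : (A.map f).index = p := by
    rw [← index_comap_of_surjective _ hfs, hAA, hA]
  have hc : (A.map f).normalCore = ⊥ := by
    rw [eq_bot_iff]
    intro y hy
    obtain ⟨x, rfl⟩ := hfs y
    rw [mem_bot, hf, QuotientGroup.mk'_apply, QuotientGroup.eq_one_iff]
    intro g
    rw [← hAA, mem_comap]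
    simpa using hy (f g)
  obtain ⟨L, hLn, hLc, hL⟩ := exists_normal_of_normalCore_eq_bot hp _ hi hc
  -- If the image of `U` contains `L`, the index is already `p` on `L`; otherwise it meets `L`,
  -- hence the derived subgroup, trivially, and so is abelian.
  by_cases hLU : L ≤ U.map f
  · right
    rw [← hAA, relIndex_comap]
    have h1 : (A.map f).relIndex L = p := by
      refine ((Nat.dvd_prime hp).1 (hLc ▸ relIndex_dvd_card _ _)).resolve_left fun h => ?_
      have : L ≤ (A.map f).normalCore := normal_le_normalCore.2 (relIndex_eq_one.1 h)
      rw [hc, le_bot_iff] at this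
      rw [this, card_bot] at hLc
      exact hp.ne_one hLc.symm
    refine le_antisymm ?_ ?_
    · conv_rhs => rw [← hi, ← relIndex_top_right]
      exact relIndex_le_of_le_right le_top (by rw [relIndex_top_right, hi]; exact hp.ne_zero)
    · conv_lhs => rw [← h1]
      exact relIndex_le_of_le_right hLU index_ne_zero_of_finite
  · left
    have hLU' : L ⊓ U.map f = ⊥ := by
      have h1 : Nat.card (L ⊓ U.map f : Subgroup _) ∣ p := hLc ▸ card_dvd_of_le inf_le_left
      rcases (Nat.dvd_prime hp).1 h1 with h | h
      · exact card_eq_one.1 h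
      · refine absurd ?_ hLU
        rw [← inf_eq_left]
        exact eq_of_le_of_card_ge inf_le_left (by rw [h, hLc])
    intro a ha b hb
    have h1 : f ⁅b, a⁆ ∈ L ⊓ U.map f := by
      refine ⟨?_, mem_map_of_mem f ?_⟩
      · rw [map_commutatorElement]
        exact hL (commutator_mem_commutator (mem_top _) (mem_top _))
      · rw [commutatorElement_def]
        exact U.mul_mem (U.mul_mem (U.mul_mem hb ha.2) (U.inv_mem hb)) (U.inv_mem ha.2)
    rw [hLU', mem_bot, commutatorElement_def, map_mul, map_inv, mul_inv_eq_one] at h1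
    rw [← hAA, mem_comap, h1]
    exact mem_map_of_mem f ha.1

/-! ### Pulling back chains: subgroups, subdirect and direct products -/

theorem IsKPtStep.comap_inf {t : ℕ} {G : Type u} {K : Type v} [Group G] [Group K] [Finite K]
    [Group.IsSolvable K] (f : G →* K) {A B : Subgroup K} (h : IsKPtStep t A B) (U : Subgroup G) :
    IsKPtStep t (A.comap f ⊓ U) (B.comap f ⊓ U) := by
  have hle : A.comap f ⊓ U ≤ B.comap f ⊓ U := inf_le_inf_right _ (comap_mono h.1)
  obtain ⟨hAB, h | ⟨p, hp, hi, hq⟩⟩ := h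
  · rw [normal_subgroupOf_iff hAB] at h
    refine isKPtStep_of_conj_mem hle fun a ha b hb => ⟨?_, ?_⟩
    · simpa using h (f a) (f b) ha.1 hb.1
    · exact U.mul_mem (U.mul_mem hb.2 ha.2) (U.inv_mem hb.2)
  -- The index to be found equals that of `A` in `V`, so the dichotomy for index `p` can be applied
  -- inside `B`.
  · set V := (B.comap f ⊓ U).map f
    have hVB : V ≤ B := (Subgroup.map_mono inf_le_left).trans (map_comap_le f B)
    rcases conj_mem_or_relIndex_eq_of_index_prime hp (A.subgroupOf B) hi (V.subgroupOf B) with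
      h | h
    · refine isKPtStep_of_conj_mem hle fun a ha b hb => ⟨?_, ?_⟩
      · simpa [mem_subgroupOf] using h ⟨f a, hAB ha.1⟩ ⟨ha.1, mem_map_of_mem f (hle ha)⟩
          ⟨f b, hb.1⟩ (mem_map_of_mem f hb)
      · exact U.mul_mem (U.mul_mem hb.2 ha.2) (U.inv_mem hb.2)
    · refine ⟨hle, .inr ⟨p, hp, ?_, hq⟩⟩
      have h1 : (A.comap f ⊓ U) ⊓ (B.comap f ⊓ U) = A.comap f ⊓ (B.comap f ⊓ U) := by
        rw [inf_assoc, inf_left_comm U, inf_idem]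
      rw [relIndex_subgroupOf hVB] at h
      rw [← inf_relIndex_right, h1, inf_relIndex_right, relIndex_comap, h]

theorem reflTransGen_isKPtStep_comap_inf {t : ℕ} {G : Type u} {K : Type v} [Group G] [Group K]
    [Finite K] [Group.IsSolvable K] (f : G →* K) {A B : Subgroup K}
    (h : ReflTransGen (IsKPtStep t) A B) (U : Subgroup G) :
    ReflTransGen (IsKPtStep t) (A.comap f ⊓ U) (B.comap f ⊓ U) :=
  h.lift (fun A => A.comap f ⊓ U) fun _ _ h => h.comap_inf f U

/-- A Sylow subgroup of `G` lies in the preimage of a Sylow subgroup of a member of the class,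
and such preimages can be intersected along chains. -/
theorem SylowKPtClass.exists_le_comap {t : ℕ} {G : Type u} {K : Type v} [Group G] [Group K]
    (hK : SylowKPtClass t K) (f : G →* K) {p : ℕ} (hp : p.Prime) {P : Subgroup G}
    (hP : IsPGroup p P) :
    ∃ H : Subgroup G, P ≤ H ∧ (∀ U : Subgroup G, ReflTransGen (IsKPtStep t) (H ⊓ U) U) ∧
      ∀ x ∈ H, ∃ k : ℕ, x ^ p ^ k ∈ f.ker := by
  have := hK.1
  have := hK.isSolvable
  obtain ⟨Q, hQ⟩ := (hP.map f).exists_le_sylow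
  refine ⟨(Q : Subgroup K).comap f, map_le_iff_le_comap.1 hQ, fun U => ?_, fun x hx => ?_⟩
  · have := reflTransGen_isKPtStep_comap_inf f
      (isKPtSubnormal_iff_reflTransGen.1 (hK.2 p hp Q)) U
    rwa [comap_top, top_inf_eq] at this
  · obtain ⟨k, hk⟩ := Q.isPGroup' ⟨f x, hx⟩
    exact ⟨k, by rw [MonoidHom.mem_ker, map_pow]; exact congrArg Subtype.val hk⟩

/-- The intersection of all `H i` is reached by concatenating chains. A high `p`-power of each of
its elements lies in every `N i`, so it is a `p`-group containing `P`, hence `P` itself. -/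
theorem sylowKPtClass_of_iInf_eq_bot {t : ℕ} {G : Type u} [Group G] [Finite G] {ι : Type w}
    [Finite ι] (N : ι → Subgroup G) (hN : ⨅ i, N i = ⊥)
    (h : ∀ i, ∀ p : ℕ, p.Prime → ∀ P : Subgroup G, IsPGroup p P → ∃ H : Subgroup G, P ≤ H ∧
      (∀ U : Subgroup G, ReflTransGen (IsKPtStep t) (H ⊓ U) U) ∧
        ∀ x ∈ H, ∃ k : ℕ, x ^ p ^ k ∈ N i) : SylowKPtClass t G := by
  classical
  have := Fintype.ofFinite ι
  refine ⟨inferInstance, fun p hp P => isKPtSubnormal_iff_reflTransGen.2 ?_⟩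
  choose H hPH hHU hHN using fun i => h i p hp P P.isPGroup'
  have hchain : ∀ s : Finset ι, ReflTransGen (IsKPtStep t) (s.inf H) ⊤ := by
    intro s
    induction s using Finset.induction_on with
    | empty => exact .refl
    | insert i s _ ih => rw [Finset.inf_insert]; exact (hHU i _).trans ih
  have hP : Finset.univ.inf H = P := by
    refine P.is_maximal' ?_ (Finset.le_inf fun i _ => hPH i)
    rintro ⟨x, hx⟩
    choose k hk using fun i => hHN i x ((Finset.inf_le (Finset.mem_univ i) : _ ≤ H i) hx)
    refine ⟨∑ i, k i, Subtype.ext ?_⟩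
    change x ^ p ^ (∑ i, k i) = 1
    rw [← mem_bot, ← hN, mem_iInf]
    intro i
    obtain ⟨m, hm⟩ := pow_dvd_pow p
      (Finset.single_le_sum (f := k) (fun j _ => Nat.zero_le _) (Finset.mem_univ i))
    rw [hm, pow_mul]
    exact (N i).pow_mem (hk i) m
  exact hP ▸ hchain Finset.univ

/-- A finite group with finitely many homomorphisms to members of the class that are jointly
injective is a member of the class. -/
theorem SylowKPtClass.of_iInf_ker_eq_bot {t : ℕ} {G : Type u} [Group G] [Finite G] {ι : Type w}
    [Finite ι] {K : ι → Type v} [∀ i, Group (K i)] (hK : ∀ i, SylowKPtClass t (K i))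
    (f : ∀ i, G →* K i) (hf : ⨅ i, (f i).ker = ⊥) : SylowKPtClass t G :=
  sylowKPtClass_of_iInf_eq_bot _ hf fun i _ hp _ hP => (hK i).exists_le_comap (f i) hp hP

theorem SylowKPtClass.of_ker_inf_ker_eq_bot {t : ℕ} {G : Type u} [Group G] [Finite G]
    {K : Type v} {L : Type w} [Group K] [Group L] (hK : SylowKPtClass t K)
    (hL : SylowKPtClass t L) (f : G →* K) (g : G →* L) (h : f.ker ⊓ g.ker = ⊥) :
    SylowKPtClass t G := by
  refine sylowKPtClass_of_iInf_eq_bot (fun b : Bool => cond b f.ker g.ker)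
    (by rw [iInf_bool_eq]; exact h) ?_
  rintro (_ | _) p hp P hP
  · exact hL.exists_le_comap g hp hP
  · exact hK.exists_le_comap f hp hP

theorem SylowKPtClass.of_injective {t : ℕ} {G : Type u} [Group G] {K : Type v} [Group K]
    (hK : SylowKPtClass t K) (f : G →* K) (hf : Function.Injective f) : SylowKPtClass t G := by
  have := hK.1
  have := Finite.of_injective f hf
  exact hK.of_ker_inf_ker_eq_bot hK f f (by rw [inf_idem, (MonoidHom.ker_eq_bot_iff f).2 hf])

theorem SylowKPtClass.subgroup {t : ℕ} {G : Type u} [Group G] (hG : SylowKPtClass t G)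
    (U : Subgroup G) : SylowKPtClass t U :=
  hG.of_injective U.subtype U.subtype_injective

theorem SylowKPtClass.quotient_inf {t : ℕ} {G : Type u} [Group G] [Finite G]
    (N₁ N₂ : Subgroup G) [N₁.Normal] [N₂.Normal] (h₁ : SylowKPtClass t (G ⧸ N₁))
    (h₂ : SylowKPtClass t (G ⧸ N₂)) : SylowKPtClass t (G ⧸ (N₁ ⊓ N₂)) := by
  refine h₁.of_ker_inf_ker_eq_bot h₂
    (QuotientGroup.map (N₁ ⊓ N₂) N₁ (MonoidHom.id G) inf_le_left)
    (QuotientGroup.map (N₁ ⊓ N₂) N₂ (MonoidHom.id G) inf_le_right) ?_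
  rw [eq_bot_iff]
  rintro x ⟨hx₁, hx₂⟩
  obtain ⟨x, rfl⟩ := QuotientGroup.mk_surjective x
  exact (QuotientGroup.eq_one_iff x).2
    ⟨(QuotientGroup.eq_one_iff (N := N₁) x).1 hx₁, (QuotientGroup.eq_one_iff (N := N₂) x).1 hx₂⟩

theorem SylowKPtClass.prod {t : ℕ} {G : Type u} {K : Type v} [Group G] [Group K]
    (hG : SylowKPtClass t G) (hK : SylowKPtClass t K) : SylowKPtClass t (G × K) := by
  have := hG.1
  have := hK.1
  refine hG.of_ker_inf_ker_eq_bot hK (MonoidHom.fst G K) (MonoidHom.snd G K) ?_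
  rw [eq_bot_iff]
  rintro ⟨x, y⟩ ⟨hx, hy⟩
  exact Prod.ext hx hy

theorem SylowKPtClass.pi {t : ℕ} {ι : Type w} [Finite ι] {G : ι → Type u} [∀ i, Group (G i)]
    (hG : ∀ i, SylowKPtClass t (G i)) : SylowKPtClass t (∀ i, G i) := by
  have := fun i => (hG i).1
  refine SylowKPtClass.of_iInf_ker_eq_bot hG (fun i => Pi.evalMonoidHom G i) ?_
  rw [eq_bot_iff]
  intro x hx
  rw [mem_iInf] at hx
  exact funext fun i => hx i

theorem sylowKPtClass_of_isNilpotent (t : ℕ) {G : Type u} [Group G] [Finite G]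
    (h : Group.IsNilpotent G) : SylowKPtClass t G := by
  have h3 := ((Group.isNilpotent_of_finite_tfae (G := G)).out 0 3 :
    Group.IsNilpotent G ↔ ∀ (p : ℕ) (_ : Fact p.Prime) (P : Sylow p G), (P : Subgroup G).Normal).1 h
  exact ⟨inferInstance, fun p hp P => isKPtSubnormal_iff_reflTransGen.2
    (.single (isKPtStep_of_normal le_top (h3 p ⟨hp⟩ P)))⟩

/-! ### Coprime action on a normal `r`-subgroup -/

theorem Subgroup.relIndex_sup_eq_of_normal {G : Type u} [Group G] [Finite G] (A N : Subgroup G)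
    [N.Normal] : A.relIndex (A ⊔ N) = A.relIndex N := by
  have h1 := relIndex_mul_relIndex ⊥ A (A ⊔ N) bot_le le_sup_left
  have h2 := relIndex_mul_relIndex ⊥ N (A ⊔ N) bot_le le_sup_right
  have h3 := relIndex_mul_relIndex ⊥ (A ⊓ N) N bot_le inf_le_right
  have h4 := relIndex_mul_relIndex ⊥ (A ⊓ N) A bot_le inf_le_left
  rw [relIndex_sup_right] at h2
  rw [inf_relIndex_right] at h3
  rw [inf_comm, inf_relIndex_right, inf_comm] at h4
  simp only [relIndex_bot_left] at h1 h2 h3 h4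
  refine Nat.eq_of_mul_eq_mul_left (Nat.card_pos (α := A)) ?_
  rw [h1, ← h2, ← h3, ← h4]
  ring

theorem eq_one_of_pow_prime_pow_eq_one {G : Type u} [Group G] {p q : ℕ} (hp : p.Prime)
    (hq : q.Prime) (hpq : p ≠ q) {x : G} {i j : ℕ} (hi : x ^ p ^ i = 1) (hj : x ^ q ^ j = 1) :
    x = 1 := by
  have h : (p ^ i).Coprime (q ^ j) := Nat.Coprime.pow _ _ ((Nat.coprime_primes hp hq).2 hpq)
  exact orderOf_eq_one_iff.1 (Nat.eq_one_of_dvd_coprimes h (orderOf_dvd_of_pow_eq_one hi)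
    (orderOf_dvd_of_pow_eq_one hj))

theorem IsPGroup.exists_pow_eq_one {G : Type u} [Group G] {p : ℕ} {P : Subgroup G}
    (hP : IsPGroup p P) {x : G} (hx : x ∈ P) : ∃ k : ℕ, x ^ p ^ k = 1 := by
  obtain ⟨k, hk⟩ := hP ⟨x, hx⟩
  exact ⟨k, congrArg Subtype.val hk⟩

/-- A supplement of prime index to a normal `r`-subgroup `R` has index `r`, and the induced action
on the quotient of `R` is abelian of exponent dividing `r - 1`. -/
theorem commutator_mem_of_index_prime {G : Type u} [Group G] [Finite G] {p r : ℕ} (hp : p.Prime)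
    (hr : r.Prime) (A R : Subgroup G) [R.Normal] (hR : IsPGroup r R) (hA : A.index = p)
    (hsup : A ⊔ R = ⊤) :
    p = r ∧ (∀ y z : G, ∀ a ∈ R, ⁅⁅y, z⁆, a⁆ ∈ A) ∧ ∀ y : G, ∀ a ∈ R, ⁅y ^ (r - 1), a⁆ ∈ A := by
  have : Fact r.Prime := ⟨hr⟩
  have hi : A.relIndex R = p := by
    rw [← relIndex_sup_eq_of_normal, hsup, relIndex_top_right, hA]
  have hpr : p = r := by
    obtain ⟨n, hn⟩ := hR.exists_card_eq
    have : p ∣ r ^ n := hn ▸ hi ▸ relIndex_dvd_card A R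
    exact (Nat.prime_dvd_prime_iff_eq hp hr).1 (hp.dvd_of_dvd_pow this)
  subst hpr
  have hNR : ((A ⊓ R).subgroupOf R).Normal := by
    have h0 : A.subgroupOf R = (A ⊓ R).subgroupOf R := (inf_subgroupOf_right A R).symm
    rw [← h0]
    apply normal_of_index_eq_minFac_card
    obtain ⟨n, hn⟩ := hR.exists_card_eq
    have hn0 : n ≠ 0 := by
      rintro rfl
      have : p ∣ 1 := by
        have h := relIndex_dvd_card A R
        rwa [hn, hi, pow_zero] at h
      exact hp.one_lt.ne' (Nat.dvd_one.1 this)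
    rw [hn, Nat.Prime.pow_minFac hp hn0]
    exact hi
  rw [normal_subgroupOf_iff inf_le_right] at hNR
  have hN : (A ⊓ R).Normal := by
    refine ⟨fun x hx g => ?_⟩
    have hg : g ∈ A ⊔ R := hsup ▸ mem_top g
    obtain ⟨a, ha, l, hl, rfl⟩ := mem_sup_of_normal_right.1 hg
    have h1 := hNR x l hx hl
    have : a * l * x * (a * l)⁻¹ = a * (l * x * l⁻¹) * a⁻¹ := by group
    rw [this]
    exact ⟨A.mul_mem (A.mul_mem ha h1.1) (A.inv_mem ha),
      (inferInstance : R.Normal).conj_mem _ h1.2 a⟩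
  set f := QuotientGroup.mk' (A ⊓ R) with hf
  have : (R.map f).Normal := Normal.map inferInstance f (QuotientGroup.mk'_surjective _)
  have hV : Nat.card (R.map f) = p := by
    rw [← relIndex_ker, hf, QuotientGroup.ker_mk', inf_relIndex_right, hi]
  obtain ⟨h1, h2⟩ := commute_of_card_normal_eq_prime hp _ hV
  have key : ∀ x a : G, Commute (f x) (f a) → ⁅x, a⁆ ∈ A := by
    intro x a h
    have : ⁅x, a⁆ ∈ A ⊓ R := by
      rw [← QuotientGroup.ker_mk' (A ⊓ R), MonoidHom.mem_ker, map_commutatorElement,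
        commutatorElement_eq_one_iff_commute]
      exact h
    exact this.1
  refine ⟨rfl, fun y z a ha => key _ _ ?_, fun y a ha => key _ _ ?_⟩
  · rw [map_commutatorElement]
    exact h1 _ _ _ (mem_map_of_mem f ha)
  · rw [map_pow]
    exact h2 _ _ (mem_map_of_mem f ha)

/-- If a `q`-subgroup `Q` is linked by a chain to its product with a normal `r`-subgroup `R`,
then `Q` acts on `R` as an abelian group of exponent dividing `r - 1`, and trivially if `r` is not
an admissible index. -/
theorem commute_of_reflTransGen_isKPtStep {t : ℕ} {G : Type u} [Group G] [Finite G] {q r : ℕ}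
    (hq : q.Prime) (hr : r.Prime) (hqr : q ≠ r) (Q R : Subgroup G) [R.Normal] (hQ : IsPGroup q Q)
    (hR : IsPGroup r R) (h : ReflTransGen (IsKPtStep t) Q (Q ⊔ R)) {x : G} (hxQ : x ∈ Q)
    (hx : (∃ y ∈ Q, ∃ z ∈ Q, x = ⁅y, z⁆) ∨ (∃ y ∈ Q, x = y ^ (r - 1)) ∨
      ¬ ∀ s : ℕ, s.Prime → ¬ s ^ (t + 1) ∣ r - 1) :
    ∀ a ∈ R, Commute x a := by
  suffices hC : ∀ C, ReflTransGen (IsKPtStep t) Q C → C ≤ Q ⊔ R → ∀ a ∈ R ⊓ C, Commute x a from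
    fun a ha => hC _ h le_rfl a ⟨ha, (le_sup_right : R ≤ Q ⊔ R) ha⟩
  obtain ⟨i, hi⟩ := hQ.exists_pow_eq_one hxQ
  intro C hC
  induction hC with
  | refl =>
    rintro - a ⟨haR, haQ⟩
    obtain ⟨j, hj⟩ := hR.exists_pow_eq_one haR
    obtain ⟨k, hk⟩ := hQ.exists_pow_eq_one haQ
    rw [eq_one_of_pow_prime_pow_eq_one hq hr hqr hk hj]
    exact Commute.one_right x
  | tail hQA hAB ih =>
    rename_i A B
    intro hBle a ha
    have hQleA := reflTransGen_isKPtStep_le hQA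
    have ih := ih (hAB.1.trans hBle)
    have hb : ⁅x, a⁆ ∈ A := by
      obtain ⟨hle, h | ⟨p, hp, hi, hpt⟩⟩ := hAB
      · have h1 := (normal_subgroupOf_iff hle).1 h _ a (inv_mem (hQleA hxQ)) ha.2
        rw [commutatorElement_def, mul_assoc, mul_assoc, ← mul_assoc a]
        exact mul_mem (hQleA hxQ) h1
      · have hsup : A.subgroupOf B ⊔ R.subgroupOf B = ⊤ := by
          rw [eq_top_iff]
          rintro ⟨b, hb⟩ -
          obtain ⟨y, hy, l, hl, rfl⟩ := mem_sup_of_normal_right.1 (hBle hb)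
          have hyB := hle (hQleA hy)
          have hlB : l ∈ B := by simpa using mul_mem (inv_mem hyB) hb
          exact mul_mem_sup (S := A.subgroupOf B) (T := R.subgroupOf B) (x := ⟨y, hyB⟩)
            (y := ⟨l, hlB⟩) (hQleA hy) hl
        obtain ⟨rfl, h1, h2⟩ := commutator_mem_of_index_prime hp hr (A.subgroupOf B)
          (R.subgroupOf B) (hR.comap_of_injective B.subtype B.subtype_injective) hi hsup
        have hQB : ∀ y ∈ Q, y ∈ B := fun y hy => hle (hQleA hy)
        rcases hx with ⟨y, hy, z, hz, rfl⟩ | ⟨y, hy, rfl⟩ | hx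
        · exact h1 ⟨y, hQB y hy⟩ ⟨z, hQB z hz⟩ ⟨a, ha.2⟩ ha.1
        · exact h2 ⟨y, hQB y hy⟩ ⟨a, ha.2⟩ ha.1
        · exact absurd hpt hx
    have hbR : ⁅x, a⁆ ∈ R := by
      rw [commutatorElement_def]
      exact R.mul_mem ((inferInstance : R.Normal).conj_mem a ha.1 x) (R.inv_mem ha.1)
    have hcomm := ih _ ⟨hbR, hb⟩
    have h1 : a * x⁻¹ * a⁻¹ = x⁻¹ * ⁅x, a⁆ := by rw [commutatorElement_def]; group
    -- As `⁅x, a⁆` commutes with `x`, raising `h1` to the power `q ^ i` kills `x`. So `⁅x, a⁆` is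
    -- both a `q`-element and an `r`-element.
    have h2 : ⁅x, a⁆ ^ q ^ i = 1 := by
      have h3 := congrArg (· ^ q ^ i) h1
      simp only [conj_pow, hcomm.inv_left.mul_pow, inv_pow, hi, inv_one, one_mul, mul_one,
        mul_inv_cancel] at h3
      exact h3.symm
    obtain ⟨j, hj⟩ := hR.exists_pow_eq_one hbR
    exact commutatorElement_eq_one_iff_commute.1
      (eq_one_of_pow_prime_pow_eq_one hq hr hqr h2 hj)

/-- In a member of the class without nontrivial normal `q`-subgroups for `q ≠ r`, a normal Sylow
`r`-subgroup contains its centralizer. -/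
theorem SylowKPtClass.centralizer_le {t : ℕ} {G : Type u} [Group G] (hG : SylowKPtClass t G)
    {r : ℕ} (hr : r.Prime) (R : Sylow r G) [(R : Subgroup G).Normal]
    (h : ∀ q, q.Prime → q ≠ r → ∀ S : Subgroup G, S.Normal → IsPGroup q S → S = ⊥) :
    centralizer (R : Set G) ≤ R := by
  have := hG.1
  have : Fact r.Prime := ⟨hr⟩
  set C := centralizer (R : Set G) with hC
  have hCn : C.Normal := by
    rw [hC]; exact (inferInstance : (centralizer ((R : Subgroup G) : Set G)).Normal)
  set Z := (R : Subgroup G).subgroupOf C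
  by_contra hle
  have hne : Nat.card (C ⧸ Z) ≠ 1 := by
    change (R : Subgroup G).relIndex C ≠ 1
    rwa [Ne, relIndex_eq_one]
  obtain ⟨s, hs, hsd, -, hsn⟩ := ((hG.subgroup C).quotient Z).exists_normal_sylow hne
  have : Fact s.Prime := ⟨hs⟩
  have hsr : s ≠ r := by
    rintro rfl
    exact R.not_dvd_index (hsd.trans (relIndex_dvd_index_of_normal (R : Subgroup G) C))
  obtain ⟨S⟩ := (inferInstance : Nonempty (Sylow s C))
  -- `S` is normal modulo the central `r`-subgroup `Z`. A conjugate of an element of `S` is thus `y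
  -- * z` with `y` in `S`, `z` in `Z`; the two commute, so `z` is also an `s`-element and vanishes.
  have hSn : (S : Subgroup C).Normal := by
    refine ⟨fun x hx c => ?_⟩
    have h1 : QuotientGroup.mk' Z x ∈
        Sylow.mapSurjective (QuotientGroup.mk'_surjective Z) S := ⟨x, hx, rfl⟩
    have h2 := (hsn (Sylow.mapSurjective (QuotientGroup.mk'_surjective Z) S)).conj_mem _ h1
      (QuotientGroup.mk' Z c)
    obtain ⟨y, hy, hyc⟩ := h2
    have hz : y⁻¹ * (c * x * c⁻¹) ∈ Z := by
      rw [← QuotientGroup.ker_mk' Z, MonoidHom.mem_ker]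
      simp only [map_mul, map_inv, hyc]
      group
    set z := y⁻¹ * (c * x * c⁻¹) with hzdef
    have hcomm : Commute y z := Subtype.ext (mem_centralizer_iff.1 y.2 z hz).symm
    obtain ⟨i, hi⟩ := S.isPGroup'.exists_pow_eq_one hx
    obtain ⟨j, hj⟩ := S.isPGroup'.exists_pow_eq_one hy
    obtain ⟨k, hk⟩ := R.isPGroup'.exists_pow_eq_one hz
    have hz1 : z ^ s ^ (i + j) = 1 := by
      have e1 : y⁻¹ ^ s ^ (i + j) = 1 := by
        rw [add_comm, pow_add, pow_mul, inv_pow, hj, inv_one, one_pow]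
      have e2 : (c * x * c⁻¹) ^ s ^ (i + j) = 1 := by
        rw [pow_add, pow_mul, conj_pow, hi, mul_one, mul_inv_cancel, one_pow]
      have e3 : Commute y⁻¹ (c * x * c⁻¹) := by
        have : c * x * c⁻¹ = y * z := by rw [hzdef]; group
        rw [this]
        exact ((Commute.refl y).mul_right hcomm).inv_left
      rw [hzdef, e3.mul_pow, e1, e2, one_mul]
    have : z = 1 := eq_one_of_pow_prime_pow_eq_one hs hr hsr hz1 (Subtype.ext hk)
    rw [hzdef, inv_mul_eq_one] at this
    exact this ▸ hy
  have := S.characteristic_of_normal hSn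
  have hbot := h s hs hsr ((S : Subgroup C).map C.subtype)
    ConjAct.normal_of_characteristic_of_normal (S.isPGroup'.map _)
  rw [map_eq_bot_iff_of_injective _ C.subtype_injective] at hbot
  have hd := S.dvd_card_of_dvd_card (hsd.trans (card_quotient_dvd_card Z))
  rw [hbot, card_bot] at hd
  exact hs.one_lt.ne' (Nat.dvd_one.1 hd)

/-! ### Eigenvectors and chains above an abelian subgroup -/

/-- The minimal polynomial divides `X ^ r - X`, which splits over the field of `r` elements. -/
theorem Module.End.exists_hasEigenvalue_of_pow_eq {M : Type u} [AddCommGroup M] [Finite M]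
    [Nontrivial M] {r : ℕ} [Fact r.Prime] [Module (ZMod r) M] (F : Module.End (ZMod r) M)
    (hF : F ^ r = F) : ∃ c : ZMod r, F.HasEigenvalue c := by
  have : Module.Finite (ZMod r) M := Module.Finite.of_finite
  have hF : Polynomial.aeval F (Polynomial.X ^ r - Polynomial.X : Polynomial (ZMod r)) = 0 := by
    rw [map_sub, map_pow, Polynomial.aeval_X, hF, sub_self]
  have hs : (Polynomial.X ^ r - Polynomial.X : Polynomial (ZMod r)).Splits := by
    have := FiniteField.splits_X_pow_card_sub_X r (K := ZMod r)
    rwa [ZMod.card, Algebra.algebraMap_self, Polynomial.map_id] at this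
  have h0 : (Polynomial.X ^ r - Polynomial.X : Polynomial (ZMod r)) ≠ 0 :=
    FiniteField.X_pow_card_sub_X_ne_zero (ZMod r) (Fact.out : r.Prime).one_lt
  have hms : (minpoly (ZMod r) F).Splits := hs.of_dvd h0 (minpoly.dvd _ _ hF)
  obtain ⟨c, hc⟩ := hms.exists_eval_eq_zero
    (minpoly.degree_pos (Algebra.IsIntegral.isIntegral F)).ne'
  exact ⟨c, Module.End.hasEigenvalue_of_isRoot hc⟩

theorem exists_eigenvector_of_iterate_eq {M : Type u} [AddCommGroup M] [Finite M] [Nontrivial M]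
    {r : ℕ} (hr : r.Prime) (hM : ∀ m : M, r • m = 0) (f : M →+ M) (hf : ∀ m, f^[r] m = f m) :
    ∃ (n : ℕ) (m : M), m ≠ 0 ∧ f m = n • m := by
  have : Fact r.Prime := ⟨hr⟩
  let : Module (ZMod r) M := AddCommGroup.zmodModule hM
  obtain ⟨c, hc⟩ := Module.End.exists_hasEigenvalue_of_pow_eq (f.toZModLinearMap r)
    (LinearMap.ext fun m => by rw [Module.End.pow_apply]; exact hf m)
  obtain ⟨m, hm⟩ := hc.exists_hasEigenvector
  refine ⟨c.val, m, hm.2, ?_⟩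
  have := hm.apply_eq_smul
  rw [← ZMod.natCast_zmod_val c, Nat.cast_smul_eq_nsmul] at this
  exact this

/-- If an abelian group of exponent dividing `r - 1` acts on a nontrivial normal `r`-subgroup `R`,
then some subgroup of order `r` of `R` is normal. -/
theorem exists_normal_card_eq_prime {G : Type u} [Group G] [Finite G] {r : ℕ} (hr : r.Prime)
    (Q R : Subgroup G) [R.Normal] (hR : IsPGroup r R) (hR1 : R ≠ ⊥) (hsup : Q ⊔ R = ⊤)
    (hQc : ∀ x ∈ Q, ∀ y ∈ Q, Commute x y) (hQe : ∀ x ∈ Q, x ^ (r - 1) = 1) :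
    ∃ W : Subgroup G, W.Normal ∧ W ≤ R ∧ Nat.card W = r := by
  have : Fact r.Prime := ⟨hr⟩
  set Z := (center R).map R.subtype with hZ
  have hZn : Z.Normal := ConjAct.normal_of_characteristic_of_normal
  have hZR : Z ≤ R := map_subtype_le _
  have hZ1 : Z ≠ ⊥ := by
    have : Nontrivial R := (nontrivial_iff_ne_bot R).2 hR1
    rw [hZ, Ne, map_eq_bot_iff_of_injective _ R.subtype_injective]
    exact hR.bot_lt_center.ne'
  have hZc : ∀ z ∈ Z, ∀ l ∈ R, Commute l z := by
    rintro _ ⟨z, hz, rfl⟩ l hl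
    exact congrArg Subtype.val (mem_center_iff.1 hz ⟨l, hl⟩)
  obtain ⟨W, ⟨hWn, hW1, hWZ⟩, hWmin⟩ :=
    (Set.toFinite {N : Subgroup G | N.Normal ∧ N ≠ ⊥ ∧ N ≤ Z}).exists_minimal ⟨Z, hZn, hZ1, le_rfl⟩
  have hWc : ∀ v ∈ W, ∀ w ∈ W, Commute v w := fun v hv w hw => hZc w (hWZ hw) v (hZR (hWZ hv))
  -- `R` centralizes `W`, so a `Q`-invariant subgroup of `W` is normal and minimality applies.
  have hmin : ∀ T : Subgroup G, T ≤ W → T ≠ ⊥ → (∀ y ∈ Q, ∀ w ∈ T, y * w * y⁻¹ ∈ T) → W ≤ T := by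
    intro T hTW hT1 hT
    refine hWmin ⟨⟨fun x hx g => ?_⟩, hT1, hTW.trans hWZ⟩ hTW
    have hg : g ∈ Q ⊔ R := hsup ▸ mem_top g
    obtain ⟨a, ha, l, hl, rfl⟩ := mem_sup_of_normal_right.1 hg
    have : a * l * x * (a * l)⁻¹ = a * (l * x * l⁻¹) * a⁻¹ := by group
    rw [this, (hZc x (hWZ (hTW hx)) l hl).eq, mul_inv_cancel_right]
    exact hT a ha x hx
  have hWexp : ∀ w ∈ W, w ^ r = 1 := by
    let T : Subgroup G :=
      { carrier := {w | w ∈ W ∧ w ^ r = 1}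
        one_mem' := ⟨W.one_mem, one_pow r⟩
        mul_mem' := fun {v w} hv hw => ⟨W.mul_mem hv.1 hw.1, by
          rw [(hWc v hv.1 w hw.1).mul_pow, hv.2, hw.2, one_mul]⟩
        inv_mem' := fun {w} hw => ⟨W.inv_mem hw.1, by rw [inv_pow, hw.2, inv_one]⟩ }
    refine fun w hw => (hmin T (fun w hw => hw.1) ?_ ?_ hw).2
    · have hd : r ∣ Nat.card W := by
        have : Nontrivial W := (nontrivial_iff_ne_bot W).2 hW1
        obtain ⟨n, hn, hc⟩ := (hR.to_le (hWZ.trans hZR)).nontrivial_iff_card.1 this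
        exact hc ▸ dvd_pow_self r hn.ne'
      obtain ⟨w, hw⟩ := exists_prime_orderOf_dvd_card' r hd
      intro hT
      have hwT : (w : G) ∈ T := ⟨w.2, by
        have := pow_orderOf_eq_one w
        rw [hw] at this
        exact congrArg Subtype.val this⟩
      rw [hT, mem_bot, OneMemClass.coe_eq_one] at hwT
      rw [hwT, orderOf_one] at hw
      exact hr.ne_one hw.symm
    · exact fun y _ w hw => ⟨hWn.conj_mem w hw.1 y, by rw [conj_pow, hw.2]; group⟩
  have hscalar : ∀ x ∈ Q, ∃ n : ℕ, ∀ w ∈ W, x * w * x⁻¹ = w ^ n := by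
    intro x hx
    let : CommGroup W := { (inferInstance : Group W) with
      mul_comm := fun v w => Subtype.ext (hWc v v.2 w w.2) }
    have : Nontrivial W := (nontrivial_iff_ne_bot W).2 hW1
    let f : W →* W := (MulAut.conjNormal x : MulAut W).toMonoidHom
    have hfi : ∀ (k : ℕ) (w : W), ((f^[k] w : W) : G) = x ^ k * w * (x ^ k)⁻¹ := by
      intro k w
      induction k with
      | zero => simp
      | succ k ih =>
        rw [Function.iterate_succ_apply']
        change x * ((f^[k] w : W) : G) * x⁻¹ = _
        rw [ih, pow_succ']
        group
    obtain ⟨n, m, hm, hfm⟩ := exists_eigenvector_of_iterate_eq (M := Additive W) hr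
      (fun m => Subtype.ext (hWexp m.toMul m.toMul.2)) (MonoidHom.toAdditive f) (fun m => by
        refine Subtype.ext ((hfi r m.toMul).trans ?_)
        have : x ^ r = x := by
          conv_lhs => rw [← Nat.sub_add_cancel hr.one_le, pow_succ, hQe x hx, one_mul]
        rw [this]
        rfl)
    have hfm : x * (m.toMul : G) * x⁻¹ = (m.toMul : G) ^ n := congrArg Subtype.val hfm
    refine ⟨n, ?_⟩
    -- `T` is an eigenspace of `x`. It is `Q`-invariant because `Q` is commutative, so it is all of
    -- `W`.
    let T : Subgroup G :=
      { carrier := {w | w ∈ W ∧ x * w * x⁻¹ = w ^ n}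
        one_mem' := ⟨W.one_mem, by simp⟩
        mul_mem' := fun {v w} hv hw => ⟨W.mul_mem hv.1 hw.1, by
          rw [(hWc v hv.1 w hw.1).mul_pow, ← hv.2, ← hw.2]; group⟩
        inv_mem' := fun {w} hw => ⟨W.inv_mem hw.1, by rw [inv_pow, ← hw.2]; group⟩ }
    refine fun w hw => (hmin T (fun w hw => hw.1) ?_ ?_ hw).2
    · intro hT
      have hmT : (m.toMul : G) ∈ T := ⟨m.toMul.2, hfm⟩
      rw [hT, mem_bot, OneMemClass.coe_eq_one] at hmT
      exact hm hmT
    · intro y hy w hw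
      refine ⟨hWn.conj_mem w hw.1 y, ?_⟩
      rw [conj_pow, ← hw.2]
      have hxy := (hQc x hx y hy).eq
      have hxy' : y⁻¹ * x⁻¹ = x⁻¹ * y⁻¹ := by rw [← mul_inv_rev, hxy, mul_inv_rev]
      calc x * (y * w * y⁻¹) * x⁻¹ = (x * y) * w * (y⁻¹ * x⁻¹) := by group
        _ = (y * x) * w * (x⁻¹ * y⁻¹) := by rw [hxy, hxy']
        _ = _ := by group
  obtain ⟨w, hw, hw1⟩ := (ne_bot_iff_exists_ne_one.1 hW1).imp fun w hw => And.intro w.2 hw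
  -- Since `Q` acts by powers, every cyclic subgroup of `W` is invariant, so `W` is cyclic.
  have hle : W ≤ zpowers (w : G) := by
    refine hmin _ (zpowers_le.2 hw) ?_ ?_
    · rw [Ne, zpowers_eq_bot, OneMemClass.coe_eq_one]
      exact hw1
    · rintro y hy _ ⟨k, rfl⟩
      obtain ⟨n, hn⟩ := hscalar y hy
      exact ⟨k * n, by
        change (w : G) ^ (k * n : ℤ) = y * (w : G) ^ k * y⁻¹
        rw [hn _ (zpow_mem hw k), ← zpow_natCast, ← zpow_mul]⟩
  refine ⟨W, hWn, hWZ.trans hZR, ?_⟩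
  rw [le_antisymm hle (zpowers_le.2 hw), Nat.card_zpowers]
  exact orderOf_eq_prime (hWexp w hw) fun h => hw1 (OneMemClass.coe_eq_one.1 h)

/-- The product of a normal `r`-subgroup and an abelian subgroup `Q` of exponent dividing `r - 1`
has a chain with factors of order `r` above `Q`. -/
theorem reflTransGen_isKPtStep_top_of_commute {t : ℕ} {r : ℕ} (hr : r.Prime)
    (hrt : ∀ q : ℕ, q.Prime → ¬ q ^ (t + 1) ∣ r - 1) {G : Type u} [Group G] [Finite G]
    [Group.IsSolvable G] (Q R : Subgroup G) [R.Normal] (hR : IsPGroup r R) (hsup : Q ⊔ R = ⊤)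
    (hQc : ∀ x ∈ Q, ∀ y ∈ Q, Commute x y) (hQe : ∀ x ∈ Q, x ^ (r - 1) = 1) :
    ReflTransGen (IsKPtStep t) Q ⊤ := by
  induction hn : Nat.card G using Nat.strong_induction_on generalizing G with
  | _ n ih =>
  subst hn
  by_cases hR1 : R = ⊥
  · rw [hR1, sup_bot_eq] at hsup
    rw [hsup]
  obtain ⟨W, hW, hWR, hWc⟩ := exists_normal_card_eq_prime hr Q R hR hR1 hsup hQc hQe
  set f := QuotientGroup.mk' W with hf
  have hfs : Function.Surjective f := QuotientGroup.mk'_surjective W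
  have hlt : Nat.card (G ⧸ W) < Nat.card G := by
    rw [card_eq_card_quotient_mul_card_subgroup W, hWc]
    exact lt_mul_of_one_lt_right Nat.card_pos hr.one_lt
  have : (R.map f).Normal := Normal.map inferInstance f hfs
  have h1 : ReflTransGen (IsKPtStep t) (Q.map f) ⊤ := by
    refine ih _ hlt (Q.map f) (R.map f) (hR.map f) ?_ ?_ ?_ rfl
    · rw [← Subgroup.map_sup, hsup, map_top_of_surjective f hfs]
    · rintro _ ⟨x, hx, rfl⟩ _ ⟨y, hy, rfl⟩
      exact (hQc x hx y hy).map f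
    · rintro _ ⟨x, hx, rfl⟩
      rw [← map_pow, hQe x hx, map_one]
  have h2 := reflTransGen_isKPtStep_comap_inf f h1 ⊤
  rw [inf_top_eq, inf_top_eq, comap_top, comap_map_eq, hf, QuotientGroup.ker_mk'] at h2
  refine ReflTransGen.head (b := Q ⊔ W) ?_ h2
  have h3 := relIndex_sup_eq_of_normal Q W
  rcases (Nat.dvd_prime hr).1 (hWc ▸ relIndex_dvd_card Q W) with h | h
  · rw [sup_eq_left.2 (relIndex_eq_one.1 h)]
    exact isKPtStep_of_conj_mem le_rfl fun a ha b hb => mul_mem (mul_mem hb ha) (inv_mem hb)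
  · exact ⟨le_sup_left, .inr ⟨r, hr, h3.trans h, hrt⟩⟩

/-! ### Frattini extensions -/

theorem le_sylow_sup_frattini {G : Type u} [Group G] [Finite G] {p : ℕ} (hp : p.Prime)
    (L : Subgroup G) (hL : IsPGroup p (L.map (QuotientGroup.mk' (frattini G)))) (P : Sylow p L) :
    L ≤ (P : Subgroup L).map L.subtype ⊔ frattini G := by
  have : Fact p.Prime := ⟨hp⟩
  set f := QuotientGroup.mk' (frattini G) with hf
  have hs := f.subgroupMap_surjective L
  have htop : (⊤ : Subgroup (L.map f)) = Sylow.mapSurjective hs P :=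
    (Sylow.mapSurjective hs P).is_maximal' (hL.of_equiv topEquiv.symm) le_top
  intro l hl
  have h1 : f.subgroupMap L ⟨l, hl⟩ ∈ Sylow.mapSurjective hs P := by
    change _ ∈ (Sylow.mapSurjective hs P : Subgroup (L.map f))
    rw [← htop]; exact mem_top _
  obtain ⟨s, hsP, hsl⟩ := h1
  have hsl : f s = f l := congrArg Subtype.val hsl
  have h2 : (s : G)⁻¹ * l ∈ frattini G := by
    rw [← QuotientGroup.ker_mk' (frattini G), MonoidHom.mem_ker, ← hf, map_mul, map_inv, hsl,
      inv_mul_cancel]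
  have h3 := mul_mem_sup (S := (P : Subgroup L).map L.subtype) ⟨s, hsP, rfl⟩ h2
  simpa using h3

/-- By the Frattini argument the normalizer of `P` and `L` generate `G`. As `L` lies in the product
of `P` and the Frattini subgroup, the normalizer is already everything. -/
theorem normal_of_isPGroup_map_frattini {G : Type u} [Group G] [Finite G] {p : ℕ} (hp : p.Prime)
    (L : Subgroup G) [L.Normal] (hL : IsPGroup p (L.map (QuotientGroup.mk' (frattini G))))
    (P : Sylow p L) : ((P : Subgroup L).map L.subtype).Normal := by
  have : Fact p.Prime := ⟨hp⟩
  have h := P.normalizer_sup_eq_top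
  rw [← normalizer_eq_top_iff]
  apply frattini_nongenerating
  rw [eq_top_iff, ← h]
  refine sup_le le_sup_left ((le_sylow_sup_frattini hp L hL P).trans ?_)
  exact sup_le_sup_right le_normalizer _

/-- The Sylow subgroup for the largest prime is normal modulo the Frattini subgroup, hence
normal. -/
theorem Sylow.normal_of_quotient_frattini {t : ℕ} {G : Type u} [Group G] [Finite G]
    (hG : SylowKPtClass t (G ⧸ frattini G)) {r : ℕ} (hr : r.Prime)
    (hmax : ∀ q, q.Prime → q ∣ Nat.card G → q ≤ r) (R : Sylow r G) : (R : Subgroup G).Normal := by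
  have : Fact r.Prime := ⟨hr⟩
  set f := QuotientGroup.mk' (frattini G) with hf
  have hfs : Function.Surjective f := QuotientGroup.mk'_surjective _
  set R' := Sylow.mapSurjective hfs R
  have hR' : (R' : Subgroup (G ⧸ frattini G)).Normal :=
    R'.normal_of_isKPtSubnormal hr (fun q hq hd => hmax q hq
      (hd.trans (card_quotient_dvd_card _))) (hG.2 r hr R')
  set L := (R' : Subgroup (G ⧸ frattini G)).comap f
  have hRL : (R : Subgroup G) ≤ L := le_comap_map f R
  have hL : IsPGroup r (L.map f) := by
    rw [map_comap_eq_self_of_surjective hfs]; exact R'.isPGroup'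
  have h := normal_of_isPGroup_map_frattini hr L hL (R.subtype hRL)
  rwa [Sylow.coe_subtype, subgroupOf_map_subtype, inf_eq_left.2 hRL] at h

/-- Lets the induction for saturation pass to quotients of `G`. -/
theorem SylowKPtClass.quotient_frattini_quotient {t : ℕ} {G : Type u} [Group G]
    (hG : SylowKPtClass t (G ⧸ frattini G)) (N : Subgroup G) [N.Normal] :
    SylowKPtClass t ((G ⧸ N) ⧸ frattini (G ⧸ N)) :=
  hG.of_surjective (QuotientGroup.map (frattini G) (frattini (G ⧸ N)) (QuotientGroup.mk' N)
    (frattini_le_comap_frattini_of_surjective (QuotientGroup.mk'_surjective N)))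
    (QuotientGroup.map_surjective_of_surjective _ _ _
      ((QuotientGroup.mk'_surjective _).comp (QuotientGroup.mk'_surjective N)) _)

theorem SylowKPtClass.of_inf_eq_bot {t : ℕ} {G : Type u} [Group G] [Finite G]
    (N₁ N₂ : Subgroup G) [N₁.Normal] [N₂.Normal] (h₁ : SylowKPtClass t (G ⧸ N₁))
    (h₂ : SylowKPtClass t (G ⧸ N₂)) (h : N₁ ⊓ N₂ = ⊥) : SylowKPtClass t G :=
  h₁.of_ker_inf_ker_eq_bot h₂ (QuotientGroup.mk' N₁) (QuotientGroup.mk' N₂)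
    (by rw [QuotientGroup.ker_mk', QuotientGroup.ker_mk', h])

/-- If the normal Sylow `r`-subgroup `R` meets every nontrivial normal subgroup, a Sylow
`q`-subgroup with `q ≠ r` acts on `R` as strongly as it does modulo the Frattini subgroup. -/
theorem eq_one_of_commute_quotient_frattini {t : ℕ} {G : Type u} [Group G] [Finite G]
    (hG : SylowKPtClass t (G ⧸ frattini G)) {q r : ℕ} (hq : q.Prime) (hr : r.Prime) (hqr : q ≠ r)
    (R : Sylow r G) [(R : Subgroup G).Normal]
    (hR : ∀ S : Subgroup G, S.Normal → (R : Subgroup G) ⊓ S = ⊥ → S = ⊥) {x : G} {k : ℕ}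
    (hx : x ^ q ^ k = 1)
    (hc : ∀ a ∈ R, Commute (QuotientGroup.mk' (frattini G) x) (QuotientGroup.mk' (frattini G) a)) :
    x = 1 := by
  have : Fact r.Prime := ⟨hr⟩
  set f := QuotientGroup.mk' (frattini G) with hf
  have hfs : Function.Surjective f := QuotientGroup.mk'_surjective _
  -- Such a Sylow subgroup is normal in `G` and meets `R` trivially.
  have key : ∀ s, s.Prime → s ≠ r → ∀ L : Subgroup G, L.Normal → IsPGroup s (L.map f) →
      ∀ P : Sylow s L, (P : Subgroup L) = ⊥ := by
    intro s hs hsr L _ hL P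
    have : Fact s.Prime := ⟨hs⟩
    have h := hR _ (normal_of_isPGroup_map_frattini hs L hL P) (disjoint_iff.1
      (IsPGroup.disjoint_of_ne r s hsr.symm _ _ R.isPGroup' (P.isPGroup'.map L.subtype)))
    rwa [map_eq_bot_iff_of_injective _ L.subtype_injective] at h
  set R' := Sylow.mapSurjective hfs R
  have : (R' : Subgroup (G ⧸ frattini G)).Normal := Normal.map inferInstance f hfs
  have hcent : centralizer (R' : Set (G ⧸ frattini G)) ≤ R' := by
    refine hG.centralizer_le hr R' fun s hs hsr S _ hS => ?_
    have hm : (S.comap f).map f = S := map_comap_eq_self_of_surjective hfs S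
    obtain ⟨P⟩ := (inferInstance : Nonempty (Sylow s (S.comap f)))
    have h := le_sylow_sup_frattini hs (S.comap f) (hm.symm ▸ hS) P
    rw [key s hs hsr (S.comap f) inferInstance (hm.symm ▸ hS) P, Subgroup.map_bot, bot_sup_eq] at h
    rw [← hm, Subgroup.map_eq_bot_iff, hf, QuotientGroup.ker_mk']
    exact h
  have hxR : f x ∈ (R' : Subgroup (G ⧸ frattini G)) := by
    apply hcent
    rw [mem_centralizer_iff]
    rintro _ ⟨a, ha, rfl⟩
    exact (hc a ha).eq.symm
  obtain ⟨j, hj⟩ := R'.isPGroup'.exists_pow_eq_one hxR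
  have hx1 : f x = 1 :=
    eq_one_of_pow_prime_pow_eq_one hq hr hqr (by rw [← map_pow, hx, map_one]) hj
  have hxF : x ∈ frattini G := by
    rwa [← QuotientGroup.ker_mk' (frattini G), MonoidHom.mem_ker]
  -- Now `x` is a `q`-element of the Frattini subgroup, whose Sylow `q`-subgroups are trivial by
  -- `key`.
  have hz : IsPGroup q (zpowers (⟨x, hxF⟩ : frattini G)) :=
    IsPGroup.of_card_dvd_pow (n := k) (by
      rw [Nat.card_zpowers]
      exact orderOf_dvd_of_pow_eq_one (Subtype.ext hx))
  obtain ⟨P, hP⟩ := hz.exists_le_sylow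
  have hF : (frattini G).map f = ⊥ := by
    rw [Subgroup.map_eq_bot_iff, hf, QuotientGroup.ker_mk']
  rw [key q hq hqr (frattini G) inferInstance (hF.symm ▸ IsPGroup.of_bot) P, zpowers_le,
    mem_bot] at hP
  exact congrArg Subtype.val hP

theorem SylowKPtClass.of_quotient_frattini {t : ℕ} {G : Type u} [Group G] [Finite G]
    (hG : SylowKPtClass t (G ⧸ frattini G)) : SylowKPtClass t G := by
  induction hn : Nat.card G using Nat.strong_induction_on generalizing G with
  | _ n ih =>
  subst hn
  have hquot : ∀ (N : Subgroup G) [N.Normal], N ≠ ⊥ → SylowKPtClass t (G ⧸ N) := by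
    intro N _ hN
    refine ih _ ?_ (hG.quotient_frattini_quotient N) rfl
    rw [card_eq_card_quotient_mul_card_subgroup N]
    exact lt_mul_of_one_lt_right Nat.card_pos ((one_lt_card_iff_ne_bot N).2 hN)
  by_cases h1 : Nat.card G = 1
  · have := (Nat.card_eq_one_iff_unique.1 h1).1
    exact sylowKPtClass_of_isNilpotent t inferInstance
  have hne : (Nat.card G).primeFactors.Nonempty :=
    Nat.nonempty_primeFactors.2 (by have := Nat.card_pos (α := G); omega)
  obtain ⟨r, hr, hrd, hmax⟩ : ∃ r : ℕ, r.Prime ∧ r ∣ Nat.card G ∧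
      ∀ q, q.Prime → q ∣ Nat.card G → q ≤ r := by
    have hr := Nat.mem_primeFactors.1 (Finset.max'_mem _ hne)
    exact ⟨_, hr.1, hr.2.1, fun q hq hd =>
      Finset.le_max' _ _ (Nat.mem_primeFactors.2 ⟨hq, hd, Nat.card_pos.ne'⟩)⟩
  have : Fact r.Prime := ⟨hr⟩
  obtain ⟨R⟩ := (inferInstance : Nonempty (Sylow r G))
  have hRn := R.normal_of_quotient_frattini hG hr hmax
  have hR1 : (R : Subgroup G) ≠ ⊥ := R.ne_bot_of_dvd_card hrd
  have hGR := hquot R hR1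
  have hsol : Group.IsSolvable G := by
    have := R.isPGroup'.isNilpotent
    have := hGR.isSolvable
    exact Group.isSolvable_of_ker_le_range (R : Subgroup G).subtype
      (QuotientGroup.mk' (R : Subgroup G)) (by simp)
  by_cases hS : ∀ S : Subgroup G, S.Normal → (R : Subgroup G) ⊓ S = ⊥ → S = ⊥
  swap
  · push Not at hS
    obtain ⟨S, hSn, hRS, hS1⟩ := hS
    exact hGR.of_inf_eq_bot _ S (hquot S hS1) hRS
  refine ⟨inferInstance, fun q hq Q => isKPtSubnormal_iff_reflTransGen.2 ?_⟩
  have : Fact q.Prime := ⟨hq⟩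
  by_cases hqr : q = r
  · subst hqr
    have hQR : Q = R := by
      have := R.unique_of_normal hRn
      exact Subsingleton.elim Q R
    exact .single (isKPtStep_of_normal le_top (hQR ▸ hRn))
  -- The upper part of the chain is pulled back from the quotient by `R`; only `Q` to `Q ⊔ R`
  -- remains.
  have hQR : ReflTransGen (IsKPtStep t) ((Q : Subgroup G) ⊔ R) ⊤ := by
    have hs := QuotientGroup.mk'_surjective (R : Subgroup G)
    have h := isKPtSubnormal_iff_reflTransGen.1 (hGR.2 q hq (Sylow.mapSurjective hs Q))
    have := hGR.isSolvable
    have h2 := reflTransGen_isKPtStep_comap_inf (QuotientGroup.mk' (R : Subgroup G)) h ⊤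
    rwa [inf_top_eq, inf_top_eq, comap_top, Sylow.coe_mapSurjective, comap_map_eq,
      QuotientGroup.ker_mk'] at h2
  refine ReflTransGen.trans ?_ hQR
  set f := QuotientGroup.mk' (frattini G) with hf
  have hfs : Function.Surjective f := QuotientGroup.mk'_surjective _
  have hact : ∀ x ∈ (Q : Subgroup G), (∃ y ∈ (Q : Subgroup G), ∃ z ∈ (Q : Subgroup G), x = ⁅y, z⁆) ∨
      (∃ y ∈ (Q : Subgroup G), x = y ^ (r - 1)) ∨ (¬ ∀ s : ℕ, s.Prime → ¬ s ^ (t + 1) ∣ r - 1) →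
      x = 1 := by
    intro x hx hcase
    obtain ⟨k, hk⟩ := Q.isPGroup'.exists_pow_eq_one hx
    refine eq_one_of_commute_quotient_frattini hG hq hr hqr R hS hk fun a ha => ?_
    have h := isKPtSubnormal_iff_reflTransGen.1 (hG.2 q hq (Sylow.mapSurjective hfs Q))
    have := hG.isSolvable
    -- Intersecting the chain of the image of `Q` with the image of `Q ⊔ R` makes it end there.
    have h2 := reflTransGen_isKPtStep_comap_inf (MonoidHom.id _) h
      ((Q : Subgroup G).map f ⊔ (R : Subgroup G).map f)
    rw [comap_id, comap_id, top_inf_eq, Sylow.coe_mapSurjective, inf_eq_left.2 le_sup_left] at h2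
    have : ((R : Subgroup G).map f).Normal := Normal.map inferInstance f hfs
    refine commute_of_reflTransGen_isKPtStep hq hr hqr _ _ (Q.isPGroup'.map f)
      (R.isPGroup'.map f) h2 (mem_map_of_mem f hx) ?_ _ (mem_map_of_mem f ha)
    rcases hcase with ⟨y, hy, z, hz, rfl⟩ | ⟨y, hy, rfl⟩ | hbad
    · exact .inl ⟨_, mem_map_of_mem f hy, _, mem_map_of_mem f hz, map_commutatorElement f y z⟩
    · exact .inr (.inl ⟨_, mem_map_of_mem f hy, map_pow f y _⟩)
    · exact .inr (.inr hbad)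
  by_cases hrt : ∀ s : ℕ, s.Prime → ¬ s ^ (t + 1) ∣ r - 1
  · set H := (Q : Subgroup G) ⊔ R with hH
    have hQH : (Q : Subgroup G) ≤ H := le_sup_left
    have hRH : (R : Subgroup G) ≤ H := le_sup_right
    have h := reflTransGen_isKPtStep_top_of_commute hr hrt ((Q : Subgroup G).subgroupOf H)
      ((R : Subgroup G).subgroupOf H)
      (R.isPGroup'.comap_of_injective H.subtype H.subtype_injective)
      (by rw [← subgroupOf_sup hQH hRH, ← hH, subgroupOf_self])
      (fun x hx y hy => Subtype.ext (commutatorElement_eq_one_iff_commute.1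
        (hact _ (by
          rw [commutatorElement_def]
          exact mul_mem (mul_mem (mul_mem hx hy) (inv_mem hx)) (inv_mem hy))
          (.inl ⟨x, hx, y, hy, rfl⟩))).eq)
      (fun x hx => Subtype.ext (hact _ (pow_mem hx _) (.inr (.inl ⟨x, hx, rfl⟩))))
    have h2 := reflTransGen_isKPtStep_map H.subtype h
    rwa [subgroupOf_map_subtype, inf_eq_left.2 hQH, ← MonoidHom.range_eq_map, range_subtype] at h2
  · have hQ1 : (Q : Subgroup G) = ⊥ :=
      (eq_bot_iff_forall _).2 fun x hx => hact x hx (.inr (.inr hrt))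
    rw [hQ1]
    exact .single (isKPtStep_of_normal bot_le inferInstance)

theorem theorem3p1 (t : ℕ) :
    -- (1) finite nilpotent groups belong to the class; its members are Ore dispersive
    ((∀ (G : Type u) [Group G] [Finite G], Group.IsNilpotent G → SylowKPtClass t G) ∧
      (∀ (G : Type u) [Group G], SylowKPtClass t G → IsOreDispersive G)) ∧
    -- (2) quotients
    (∀ (G : Type u) [Group G] (N : Subgroup G) [N.Normal],
      SylowKPtClass t G → SylowKPtClass t (G ⧸ N)) ∧
    -- (3) subdirect products
    (∀ (G : Type u) [Group G] [Finite G] (N₁ N₂ : Subgroup G) [N₁.Normal] [N₂.Normal],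
      SylowKPtClass t (G ⧸ N₁) → SylowKPtClass t (G ⧸ N₂) →
        SylowKPtClass t (G ⧸ (N₁ ⊓ N₂))) ∧
    -- (4) direct products, of two groups and of finite families
    ((∀ (G : Type u) (K : Type v) [Group G] [Group K],
        SylowKPtClass t G → SylowKPtClass t K → SylowKPtClass t (G × K)) ∧
      (∀ (ι : Type w) [Finite ι] (G : ι → Type u) [∀ i, Group (G i)],
        (∀ i, SylowKPtClass t (G i)) → SylowKPtClass t (∀ i, G i))) ∧
    -- (5) subgroups
    (∀ (G : Type u) [Group G] (U : Subgroup G), SylowKPtClass t G → SylowKPtClass t U) ∧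
    -- (6) Frattini extensions
    (∀ (G : Type u) [Group G] [Finite G],
      SylowKPtClass t (G ⧸ frattini G) → SylowKPtClass t G) ∧
    -- (7) the class is a hereditary saturated formation
    (IsFormation.{u} (fun G _ => SylowKPtClass t G) ∧
      IsHereditary.{u} (fun G _ => SylowKPtClass t G) ∧
      IsSaturated.{u} (fun G _ => SylowKPtClass t G)) := by
  exact ⟨⟨fun G _ _ h => sylowKPtClass_of_isNilpotent t h, fun G _ h => h.isOreDispersive⟩,
    fun G _ N _ h => h.quotient N, fun G _ _ N₁ N₂ _ _ h₁ h₂ => .quotient_inf N₁ N₂ h₁ h₂,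
    ⟨fun G K _ _ hG hK => hG.prod hK, fun ι _ G _ hG => .pi hG⟩, fun G _ U h => h.subgroup U,
    fun G _ _ h => h.of_quotient_frattini,
    { finite := fun G _ h => h.1
      iso := fun G K _ _ ⟨e⟩ h => h.of_surjective e.toMonoidHom e.surjective
      quotient := fun G _ N _ h => h.quotient N
      subdirect := fun G _ _ N₁ N₂ _ _ h₁ h₂ => .quotient_inf N₁ N₂ h₁ h₂ },
    fun G _ U h => h.subgroup U, fun G _ _ h => h.of_quotient_frattini⟩
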